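/- **Model.** A finite set of $N$ base stations $i$ serves a finite set of users $u$; user $u$ is associated to one base station and can be served by the stations $j\in\mathcal N_u$. In each slot $t$ a random state is revealed: traffic rates $0\le\mu_u^t\le\mu^{\max}$, task rates $0\le\lambda_u^t\le\lambda^{\max}$, renewable energy arrivals $0\le\mathcal E_i^t\le\mathcal E^{\max}$, a grid price $c^t_{grid}\ge0$, and energies per transmission $p^t_{i,u}\ge p^{\min}>0$. The states are independent and identically distributed over the slots. A decision consists of $\alpha_{u,j},\beta_{u,j}\ge0$ $(j\in\mathcal N_u)$, $e_i$, $g_i$, subject to the slot constraints $$\sum_{j\in\mathcal N_u}\alpha_{u,j}\le\mu_u^t,\quad \sum_{j\in\mathcal N_u}\beta_{u,j}\le\lambda_u^t,\quad \sum_u\beta_{u,i}\le \frac{f_i}{\rho}-\frac1{d^{\max}},\quad 0\le e_i\le\mathcal E_i^t,\quad 0\le g_i\le g^{\max},$$ where $f_i,\rho,d^{\max}>0$ and $f_i/\rho\ge 1/d^{\max}$. Station $i$ consumes the energy $E_i^t=\sum_u p^t_{i,u}\alpha_{u,i}+\kappa f_i^2\sum_u\beta_{u,i}$ ($\kappa>0$),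 whose two terms are at most $E_{tx}^{\max}$ and $E_{com}^{\max}$ for all decisions that satisfy the slot constraints; $E^{\max}=E^{\max}_{tx}+E^{\max}_{com}$. With unit dropping costs $c_{tx,u},c_{com,u}\ge0$ and $\mathcal U_i$ the users associated to $i$, its cost is $$C_i^t=\sum_{u\in\mathcal U_i}c_{tx,u}\Big(\mu^t_u-\sum_{j\in\mathcal N_u}\alpha_{u,j}\Big)+\sum_{u\in\mathcal U_i}c_{com,u}\Big(\lambda^t_u-\sum_{j\in\mathcal N_u}\beta_{u,j}\Big)+c^t_{grid}\,g_i .$$ The battery levels start in $[0,B^{\max}]$ and follow $B_i^{t+1}=\min\{B_i^t-E_i^t+e_i^t+g_i^t,\;B^{\max}\}$. **P1.** Minimize the long-run time average of the expected total cost $\sum_i\mathbb E[C_i^t]$ subject to the slot constraints and to $E_i^t\le B_i^t$ for all $i,t$. Let $C_1^*$ be the infimum over all policies that satisfy these constraints almost surely, including offline ones whose decisions depend on the entire (past and future) state sequence; for a policy whose averages do not converge, their $\liminf$ is taken. **GLOBE.** Let $c^{\max}=\max\big\{\max_u c_{tx,u}/p^{\min},\ \max_u c_{com,u}/(\kappa\,(\min_i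 f_i)^2)\big\}$ and $\theta=Vc^{\max}+E^{\max}$. In each slot, GLOBE takes, from the information available up to that slot, any minimizer of $$\textbf{P3}:\qquad \sum_i\Big(V\,C_i^t-(B_i^t-\theta)\,(E_i^t-g_i-e_i)\Big)$$ subject to the slot constraints. **Theorem.** For every $V>0$ and every $B^{\max}\ge Vc^{\max}+E^{\max}+\mathcal E^{\max}+g^{\max}$, GLOBE produces a feasible solution of P1, and its costs satisfy $$\limsup_{T\to\infty}\frac1T\sum_{t=1}^{T}\sum_i\mathbb E[C_i^t]\ \le\ C_1^*+\frac DV,\qquad D=\frac N2\Big((E^{\max})^2+(\mathcal E^{\max}+g^{\max})^2\Big).$$ In particular, the constant $D$ does not depend on $V$, so that a battery capacity growing linearly in $V$ gives a cost gap of order $1/V$. -/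

import Mathlib

open MeasureTheory ProbabilityTheory Filter
open scoped ENNReal

noncomputable section

/-- The system state of one slot: traffic arrival rates `μ_u`, task arrival rates `λ_u`, arriving
renewable energy `𝓔_i`, grid price `c_grid`, and energies per transmission `p_{i,u}`. -/
abbrev SlotState (BS U : Type*) : Type _ :=
  (U → ℝ) × (U → ℝ) × (BS → ℝ) × ℝ × (BS → U → ℝ)

namespace SlotState

variable {BS U : Type*}

/-- Communication traffic arrival rate `μ_u`. -/
abbrev traffic (s : SlotState BS U) : U → ℝ := s.1

/-- Computation task arrival rate `λ_u`. -/
abbrev tasks (s : SlotState BS U) : U → ℝ := s.2.1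

/-- Arriving renewable energy `𝓔_i`. -/
abbrev arrival (s : SlotState BS U) : BS → ℝ := s.2.2.1

/-- Unit price `c_grid` of grid energy. -/
abbrev price (s : SlotState BS U) : ℝ := s.2.2.2.1

/-- Expected energy `p_{i,u}` per transmission from base station `i` to user `u`. -/
abbrev p (s : SlotState BS U) : BS → U → ℝ := s.2.2.2.2

end SlotState

/-- The decision of one slot: transmission balancing `α_{u,j}`, computation balancing `β_{u,j}`,
harvested energy `e_i`, purchased grid energy `g_i`. -/
abbrev Decision (BS U : Type*) : Type _ :=
  (U → BS → ℝ) × (U → BS → ℝ) × (BS → ℝ) × (BS → ℝ)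

namespace Decision

variable {BS U : Type*}

/-- Transmission load balancing `α_{u,j}`. -/
abbrev α (x : Decision BS U) : U → BS → ℝ := x.1

/-- Computation load balancing `β_{u,j}`. -/
abbrev β (x : Decision BS U) : U → BS → ℝ := x.2.1

/-- Harvested energy `e_i`. -/
abbrev e (x : Decision BS U) : BS → ℝ := x.2.2.1

/-- Purchased grid energy `g_i`. -/
abbrev g (x : Decision BS U) : BS → ℝ := x.2.2.2

end Decision

/-- The static data of the network. -/
structure Network (BS U : Type*) where
  /-- the base station to which a user is associated: `U_i = {u | home u = i}` -/
  home : U → BS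
  /-- the base stations `N_u` in the transmission range of a user -/
  reach : U → Finset BS
  /-- CPU speeds `f_i` -/
  f : BS → ℝ
  /-- mean number `ρ` of CPU cycles per task -/
  ρ : ℝ
  /-- maximal delay `d^max` -/
  dMax : ℝ
  /-- unit task energy coefficient `κ` -/
  κ : ℝ
  /-- unit dropping cost `c_{tx,u}` of traffic -/
  cTx : U → ℝ
  /-- unit dropping cost `c_{com,u}` of tasks -/
  cCom : U → ℝ
  /-- maximal traffic arrival rate `μ^max` -/
  trafficMax : ℝ
  /-- maximal task arrival rate `λ^max` -/
  tasksMax : ℝ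
  /-- maximal renewable energy arrival `𝓔^max` -/
  arrivalMax : ℝ
  /-- maximal grid energy purchase `g^max` -/
  gMax : ℝ
  /-- positive lower bound `p^min` of the energies per transmission -/
  pMin : ℝ
  /-- upper bound `E_tx^max` of the transmission energy of a base station in a slot -/
  ETxMax : ℝ
  /-- upper bound `E_com^max` of the computation energy of a base station in a slot -/
  EComMax : ℝ
  f_pos : ∀ i, 0 < f i
  ρ_pos : 0 < ρ
  dMax_pos : 0 < dMax
  κ_pos : 0 < κ
  cTx_nonneg : ∀ u, 0 ≤ cTx u
  cCom_nonneg : ∀ u, 0 ≤ cCom u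
  gMax_nonneg : 0 ≤ gMax
  pMin_pos : 0 < pMin
  /-- an idle base station meets the delay constraint -/
  capacity_nonneg : ∀ i, 0 ≤ f i / ρ - 1 / dMax

namespace Network

variable {BS U : Type*} [Fintype BS] [Fintype U] [DecidableEq BS] (net : Network BS U)

/-- Transmission energy consumption `E_{tx,i}` of base station `i`. -/
def txEnergy (s : SlotState BS U) (x : Decision BS U) (i : BS) : ℝ :=
  ∑ u, s.p i u * x.α u i

/-- Computation energy consumption `E_{com,i}` of base station `i`. -/
def comEnergy (x : Decision BS U) (i : BS) : ℝ :=
  net.κ * net.f i ^ 2 * ∑ u, x.β u i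

/-- Total energy consumption `E_i` of base station `i`. -/
def energy (s : SlotState BS U) (x : Decision BS U) (i : BS) : ℝ :=
  txEnergy s x i + net.comEnergy x i

/-- Traffic dropping cost `C_{tx,i}`. -/
def txCost (s : SlotState BS U) (x : Decision BS U) (i : BS) : ℝ :=
  ∑ u with net.home u = i, net.cTx u * (s.traffic u - ∑ j ∈ net.reach u, x.α u j)

/-- Task dropping cost `C_{com,i}`. -/
def comCost (s : SlotState BS U) (x : Decision BS U) (i : BS) : ℝ :=
  ∑ u with net.home u = i, net.cCom u * (s.tasks u - ∑ j ∈ net.reach u, x.β u j)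

/-- Grid energy cost `C_{grid,i}`. -/
def gridCost (s : SlotState BS U) (x : Decision BS U) (i : BS) : ℝ :=
  s.price * x.g i

/-- Total cost `C_i` of base station `i`. -/
def cost (s : SlotState BS U) (x : Decision BS U) (i : BS) : ℝ :=
  net.txCost s x i + net.comCost s x i + gridCost s x i

/-- The constraints on a decision within one slot, apart from the energy causality constraint.
The variables `α_{u,j}`, `β_{u,j}` exist only for `j ∈ N_u`; they are set to `0` elsewhere. -/
structure SlotFeasible (s : SlotState BS U) (x : Decision BS U) : Prop where
  α_nonneg : ∀ u j, 0 ≤ x.α u j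
  β_nonneg : ∀ u j, 0 ≤ x.β u j
  α_reach : ∀ u j, j ∉ net.reach u → x.α u j = 0
  β_reach : ∀ u j, j ∉ net.reach u → x.β u j = 0
  traffic_demand : ∀ u, ∑ j ∈ net.reach u, x.α u j ≤ s.traffic u
  tasks_demand : ∀ u, ∑ j ∈ net.reach u, x.β u j ≤ s.tasks u
  capacity : ∀ i, ∑ u, x.β u i ≤ net.f i / net.ρ - 1 / net.dMax
  e_nonneg : ∀ i, 0 ≤ x.e i
  e_le : ∀ i, x.e i ≤ s.arrival i
  g_nonneg : ∀ i, 0 ≤ x.g i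
  g_le : ∀ i, x.g i ≤ net.gMax

/-- The boundedness assumptions on the state of a slot. -/
structure Admissible (s : SlotState BS U) : Prop where
  traffic_nonneg : ∀ u, 0 ≤ s.traffic u
  traffic_le : ∀ u, s.traffic u ≤ net.trafficMax
  tasks_nonneg : ∀ u, 0 ≤ s.tasks u
  tasks_le : ∀ u, s.tasks u ≤ net.tasksMax
  arrival_nonneg : ∀ i, 0 ≤ s.arrival i
  arrival_le : ∀ i, s.arrival i ≤ net.arrivalMax
  price_nonneg : 0 ≤ s.price
  pMin_le : ∀ i u, net.pMin ≤ s.p i u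
  txEnergy_le : ∀ x, net.SlotFeasible s x → ∀ i, txEnergy s x i ≤ net.ETxMax
  comEnergy_le : ∀ x, net.SlotFeasible s x → ∀ i, net.comEnergy x i ≤ net.EComMax

/-- `E^max = E_tx^max + E_com^max`. -/
def EMax : ℝ := net.ETxMax + net.EComMax

/-- `c^max = max {c_tx^max / p^min, c_com^max / (κ (f^min)^2)}`. -/
def cMax : ℝ :=
  max ((⨆ u, net.cTx u) / net.pMin) ((⨆ u, net.cCom u) / (net.κ * (⨅ i, net.f i) ^ 2))

/-- The perturbation parameter `θ = V c^max + E^max`. -/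
def θ (V : ℝ) : ℝ := V * net.cMax + net.EMax

/-- The constant `D = (N / 2) ((E^max)^2 + (𝓔^max + g^max)^2)`; it does not involve `V`. -/
def D : ℝ :=
  Fintype.card BS / 2 * (net.EMax ^ 2 + (net.arrivalMax + net.gMax) ^ 2)

/-- The battery levels along a path of states and decisions, for capacity `Bmax` and initial
levels `B₀`: `B_i^{t+1} = min {B_i^t - E_i^t + e_i^t + g_i^t, Bmax}`. -/
def battery (Bmax : ℝ) (B₀ : BS → ℝ) (s : ℕ → SlotState BS U) (x : ℕ → Decision BS U) :
    ℕ → BS → ℝ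
  | 0 => B₀
  | t + 1 => fun i =>
      min (battery Bmax B₀ s x t i - net.energy (s t) (x t) i + (x t).e i + (x t).g i) Bmax

/-- The objective of the per-slot problem P3 at battery levels `b`. -/
def objectiveP3 (V : ℝ) (b : BS → ℝ) (s : SlotState BS U) (x : Decision BS U) : ℝ :=
  ∑ i, (V * net.cost s x i - (b i - net.θ V) * (net.energy s x i - x.g i - x.e i))

/-- `x` is an optimal solution of the per-slot problem P3. -/
def SolvesP3 (V : ℝ) (b : BS → ℝ) (s : SlotState BS U) (x : Decision BS U) : Prop :=
  net.SlotFeasible s x ∧ IsMinOn (net.objectiveP3 V b s) {y | net.SlotFeasible s y} x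

variable {Ω : Type*} [MeasurableSpace Ω] (P : Measure Ω)

/-- `x` is a feasible solution of P1. The decisions may depend on the whole outcome `ω`, that is,
on all past and future states, and on extra randomness if `Ω` carries any. -/
structure FeasibleP1 (Bmax : ℝ) (B₀ : BS → ℝ) (S : ℕ → Ω → SlotState BS U)
    (x : ℕ → Ω → Decision BS U) : Prop where
  measurable : ∀ t, Measurable (x t)
  slotFeasible : ∀ᵐ ω ∂P, ∀ t, net.SlotFeasible (S t ω) (x t ω)
  causality : ∀ᵐ ω ∂P, ∀ t i, net.energy (S t ω) (x t ω) i ≤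
    net.battery Bmax B₀ (fun r => S r ω) (fun r => x r ω) t i

/-- The expected system cost averaged over the first `T` slots. On feasible decisions the cost is
nonnegative, so that its expectation makes sense in `[0, ∞]`. -/
def avgCost (S : ℕ → Ω → SlotState BS U) (x : ℕ → Ω → Decision BS U) (T : ℕ) : ℝ≥0∞ :=
  (∑ t ∈ Finset.range T, ∫⁻ ω, ENNReal.ofReal (∑ i, net.cost (S t ω) (x t ω) i) ∂P) / T

/-- The optimal value `C₁*` of P1 over all feasible policies, clairvoyant ones included. For a
policy whose averages do not converge, their lower limit is taken. -/
def optP1 (Bmax : ℝ) (B₀ : BS → ℝ) (S : ℕ → Ω → SlotState BS U) : ℝ≥0∞ :=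
  ⨅ (x : ℕ → Ω → Decision BS U) (_ : net.FeasibleP1 P Bmax B₀ S x),
    liminf (net.avgCost P S x) atTop

/-- `x` is produced by GLOBE: in each slot an optimal solution of P3 for the current state and
battery level is chosen (ties are broken arbitrarily), on the information available then. -/
structure IsGLOBE (ℱ : Filtration ℕ ‹MeasurableSpace Ω›) (V Bmax : ℝ) (B₀ : BS → ℝ)
    (S : ℕ → Ω → SlotState BS U) (x : ℕ → Ω → Decision BS U) : Prop where
  adapted : ∀ t, Measurable[ℱ t] (x t)
  solves : ∀ᵐ ω ∂P, ∀ t,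
    net.SolvesP3 V (net.battery Bmax B₀ (fun r => S r ω) (fun r => x r ω) t) (S t ω) (x t ω)

end Network

/-- The states are i.i.d. over slots; `ℱ t` is the information available in slot `t` (the states
of the slots up to `t`, and possibly randomness used to break ties). -/
structure IIDStates {BS U Ω : Type*} [MeasurableSpace Ω] (P : Measure Ω)
    (ℱ : Filtration ℕ ‹MeasurableSpace Ω›) (S : ℕ → Ω → SlotState BS U) : Prop where
  adapted : ∀ t, Measurable[ℱ t] (S t)
  identDistrib : ∀ t, IdentDistrib (S t) (S 0) P P
  indep : ∀ t, Indep (MeasurableSpace.comap (S (t + 1)) inferInstance) (ℱ t) P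

end

set_option linter.unusedSectionVars false

noncomputable section

namespace Network

variable {BS U : Type*} [Fintype BS] [Fintype U] [DecidableEq BS] (net : Network BS U)

/-! ### Bounds within one slot. -/

section Slot

variable {net} {s : SlotState BS U} {x : Decision BS U}

/-! The causality constraint couples the slots, but GLOBE meets it without imposing it. P3 splits
over the stations. Above `θ` its battery term penalizes charging, so a minimizer does not charge.
Below `EMax` each unit of consumed energy is charged more than `V * cMax`, the most it can save in
dropping costs, so the station idles. Hence consumption never exceeds the battery level
(`SolvesP3.energy_le_level`), and the capacity is never exceeded (`SolvesP3.no_overflow`).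

Without overflow the battery recursion is linear, and the drift of the sum of `(b i - θ)² / 2`
gives: `V` times the cost plus the drift is at most the objective of P3 plus `D` (`drift_le`).
Summation over the slots leaves the average of the optimal values of P3 to be compared with `V`
times `optP1`.

This comparison is weak Lagrangian duality; no optimal stationary policy is constructed. Freeze
levels `b` in `[0, Bmax]`. Once overflowing energy is no longer drawn, the battery terms of any
feasible path telescope to a bounded quantity (`exists_sum_objectiveP3_le`). So the optimal values
of P3 at `b` bound the costs from below on average, path by path and hence also for clairvoyant
policies; equality of the state laws turns this into a bound on one expectation
(`lintegral_valueP3_le_optP1`). GLOBE's level in a slot is independent of the state of that slot, so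
Fubini allows `b` to be replaced by that random level (`IsGLOBE.lintegral_valueP3_le`). -/

theorem SlotFeasible.txEnergy_nonneg (hs : net.Admissible s) (hx : net.SlotFeasible s x) (i : BS) :
    0 ≤ txEnergy s x i :=
  Finset.sum_nonneg fun u _ =>
    mul_nonneg (net.pMin_pos.le.trans (hs.pMin_le i u)) (hx.α_nonneg u i)

theorem SlotFeasible.comEnergy_nonneg (hx : net.SlotFeasible s x) (i : BS) :
    0 ≤ net.comEnergy x i :=
  mul_nonneg (mul_nonneg net.κ_pos.le (sq_nonneg _))
    (Finset.sum_nonneg fun u _ => hx.β_nonneg u i)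

theorem SlotFeasible.energy_nonneg (hs : net.Admissible s) (hx : net.SlotFeasible s x) (i : BS) :
    0 ≤ net.energy s x i :=
  add_nonneg (hx.txEnergy_nonneg hs i) (hx.comEnergy_nonneg i)

theorem SlotFeasible.energy_le (hs : net.Admissible s) (hx : net.SlotFeasible s x) (i : BS) :
    net.energy s x i ≤ net.EMax :=
  add_le_add (hs.txEnergy_le x hx i) (hs.comEnergy_le x hx i)

theorem SlotFeasible.cost_nonneg (hs : net.Admissible s) (hx : net.SlotFeasible s x) (i : BS) :
    0 ≤ net.cost s x i := by
  refine add_nonneg (add_nonneg ?_ ?_) (mul_nonneg hs.price_nonneg (hx.g_nonneg i))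
  · exact Finset.sum_nonneg fun u _ =>
      mul_nonneg (net.cTx_nonneg u) (sub_nonneg.2 (hx.traffic_demand u))
  · exact Finset.sum_nonneg fun u _ =>
      mul_nonneg (net.cCom_nonneg u) (sub_nonneg.2 (hx.tasks_demand u))

theorem SlotFeasible.charge_le (hs : net.Admissible s) (hx : net.SlotFeasible s x) (i : BS) :
    x.e i + x.g i ≤ net.arrivalMax + net.gMax :=
  add_le_add ((hx.e_le i).trans (hs.arrival_le i)) (hx.g_le i)

theorem SlotFeasible.charge_nonneg (hx : net.SlotFeasible s x) (i : BS) :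
    0 ≤ x.e i + x.g i :=
  add_nonneg (hx.e_nonneg i) (hx.g_nonneg i)

theorem SlotFeasible.sum_α (hx : net.SlotFeasible s x) (u : U) :
    ∑ j ∈ net.reach u, x.α u j = ∑ j, x.α u j :=
  Finset.sum_subset (Finset.subset_univ _) fun j _ hj => hx.α_reach u j hj

theorem SlotFeasible.sum_β (hx : net.SlotFeasible s x) (u : U) :
    ∑ j ∈ net.reach u, x.β u j = ∑ j, x.β u j :=
  Finset.sum_subset (Finset.subset_univ _) fun j _ hj => hx.β_reach u j hj

/-- The total cost, regrouped by the base stations that serve the requests. -/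
theorem SlotFeasible.sum_cost (hx : net.SlotFeasible s x) :
    ∑ i, net.cost s x i = ∑ u, (net.cTx u * s.traffic u + net.cCom u * s.tasks u) +
      ∑ i, (s.price * x.g i - ∑ u, (net.cTx u * x.α u i + net.cCom u * x.β u i)) := by
  simp only [cost, txCost, comCost, gridCost, Finset.sum_add_distrib, Finset.sum_sub_distrib,
    Finset.sum_fiberwise, hx.sum_α, hx.sum_β, mul_sub, Finset.mul_sum]
  rw [Finset.sum_comm (f := fun u i => net.cTx u * x.α u i),
    Finset.sum_comm (f := fun u i => net.cCom u * x.β u i)]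
  ring

end Slot

/-! ### Exchange arguments for minimizers of P3, station by station. -/

/-- The part of the objective of P3 that depends on the decisions concerning base station `i`. -/
def stationObjective (V : ℝ) (b : BS → ℝ) (s : SlotState BS U) (x : Decision BS U) (i : BS) : ℝ :=
  V * (s.price * x.g i - ∑ u, (net.cTx u * x.α u i + net.cCom u * x.β u i)) -
    (b i - net.θ V) * (net.energy s x i - x.g i - x.e i)

section Slot

variable {net} {V : ℝ} {b : BS → ℝ} {s : SlotState BS U} {x y : Decision BS U}

theorem SlotFeasible.objectiveP3_eq (hx : net.SlotFeasible s x) :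
    net.objectiveP3 V b s x = V * ∑ u, (net.cTx u * s.traffic u + net.cCom u * s.tasks u) +
      ∑ i, net.stationObjective V b s x i := by
  simp only [objectiveP3, stationObjective, Finset.sum_sub_distrib (f := fun i => V * _),
    ← Finset.mul_sum, hx.sum_cost]
  ring

theorem SolvesP3.stationObjective_le (hx : net.SolvesP3 V b s x) (hy : net.SlotFeasible s y)
    (i : BS) (hxy : ∀ j, j ≠ i → net.stationObjective V b s y j = net.stationObjective V b s x j) :
    net.stationObjective V b s x i ≤ net.stationObjective V b s y i := by
  have h : net.objectiveP3 V b s x ≤ net.objectiveP3 V b s y := hx.2 hy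
  rw [hx.1.objectiveP3_eq, hy.objectiveP3_eq, ← Finset.add_sum_erase _ _ (Finset.mem_univ i),
    ← Finset.add_sum_erase _ (net.stationObjective V b s y) (Finset.mem_univ i),
    Finset.sum_congr rfl fun j hj => hxy j (Finset.ne_of_mem_erase hj)] at h
  linarith

theorem SlotFeasible.mono {y : Decision BS U} (hx : net.SlotFeasible s x)
    (α₀ : ∀ u j, 0 ≤ y.α u j) (α₁ : ∀ u j, y.α u j ≤ x.α u j)
    (β₀ : ∀ u j, 0 ≤ y.β u j) (β₁ : ∀ u j, y.β u j ≤ x.β u j)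
    (e₀ : ∀ i, 0 ≤ y.e i) (e₁ : ∀ i, y.e i ≤ x.e i)
    (g₀ : ∀ i, 0 ≤ y.g i) (g₁ : ∀ i, y.g i ≤ x.g i) : net.SlotFeasible s y where
  α_nonneg := α₀
  β_nonneg := β₀
  α_reach u j hj := le_antisymm ((α₁ u j).trans (hx.α_reach u j hj).le) (α₀ u j)
  β_reach u j hj := le_antisymm ((β₁ u j).trans (hx.β_reach u j hj).le) (β₀ u j)
  traffic_demand u := (Finset.sum_le_sum fun j _ => α₁ u j).trans (hx.traffic_demand u)
  tasks_demand u := (Finset.sum_le_sum fun j _ => β₁ u j).trans (hx.tasks_demand u)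
  capacity i := (Finset.sum_le_sum fun u _ => β₁ u i).trans (hx.capacity i)
  e_nonneg := e₀
  e_le i := (e₁ i).trans (hx.e_le i)
  g_nonneg := g₀
  g_le i := (g₁ i).trans (hx.g_le i)

/-- Above the level `θ`, GLOBE does not charge the battery. -/
theorem SolvesP3.charge_eq_zero (hV : 0 < V) (hs : net.Admissible s) (hx : net.SolvesP3 V b s x)
    {i : BS} (hb : net.θ V < b i) : x.e i + x.g i = 0 := by
  let y : Decision BS U := (x.α, x.β, fun j => if j = i then 0 else x.e j,
    fun j => if j = i then 0 else x.g j)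
  have hy : net.SlotFeasible s y := by
    refine hx.1.mono hx.1.α_nonneg (fun _ _ => le_rfl) hx.1.β_nonneg (fun _ _ => le_rfl) ?_ ?_ ?_ ?_
    all_goals
      intro j
      have := hx.1.e_nonneg j
      have := hx.1.g_nonneg j
      simp only [y, Decision.e, Decision.g] at *
      split_ifs <;> first | exact le_rfl | assumption
  have h := hx.stationObjective_le hy i fun j hj => by
    simp [stationObjective, y, hj, energy, txEnergy, comEnergy, Decision.α, Decision.β,
      Decision.e, Decision.g]
  have hE : net.energy s y i = net.energy s x i := rfl
  have he : y.e i = 0 := by simp [y, Decision.e]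
  have hg : y.g i = 0 := by simp [y, Decision.g]
  have hα : y.α = x.α := rfl
  have hβ : y.β = x.β := rfl
  rw [stationObjective, stationObjective, hE, he, hg, hα, hβ] at h
  have h1 : 0 ≤ V * (s.price * x.g i) :=
    mul_nonneg hV.le (mul_nonneg hs.price_nonneg (hx.1.g_nonneg i))
  -- The price may be zero, so strictness comes from `b i > θ` alone.
  have h2 : (b i - net.θ V) * (x.e i + x.g i) ≤ 0 := by linarith
  exact le_antisymm (nonpos_of_mul_nonpos_right h2 (sub_pos.2 hb)) (hx.1.charge_nonneg i)

variable (net) in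
theorem cTx_le (u : U) : net.cTx u ≤ net.cMax * net.pMin := by
  rw [← div_le_iff₀ net.pMin_pos]
  refine le_trans ?_ (le_max_left _ _)
  exact div_le_div_of_nonneg_right (le_ciSup (Set.finite_range _).bddAbove u) net.pMin_pos.le

variable (net) in
theorem cMax_nonneg : 0 ≤ net.cMax :=
  (div_nonneg (Real.iSup_nonneg net.cTx_nonneg) net.pMin_pos.le).trans (le_max_left _ _)

variable (net) in
theorem cCom_le (u : U) (i : BS) : net.cCom u ≤ net.cMax * (net.κ * net.f i ^ 2) := by
  -- With a station at hand the infimum of the speeds is attained, hence positive, and the quotient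
  -- in `cMax` is a genuine one.
  have : Nonempty BS := ⟨i⟩
  obtain ⟨j, hj⟩ := exists_eq_ciInf_of_finite (f := net.f)
  have h0 : 0 < ⨅ i, net.f i := hj ▸ net.f_pos j
  have h1 : ⨅ i, net.f i ≤ net.f i := ciInf_le (Set.finite_range _).bddBelow i
  have h2 : net.cCom u ≤ net.cMax * (net.κ * (⨅ i, net.f i) ^ 2) := by
    rw [← div_le_iff₀ (mul_pos net.κ_pos (pow_pos h0 2))]
    refine le_trans ?_ (le_max_right _ _)
    exact div_le_div_of_nonneg_right (le_ciSup (Set.finite_range _).bddAbove u)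
      (mul_pos net.κ_pos (pow_pos h0 2)).le
  refine h2.trans (mul_le_mul_of_nonneg_left ?_ net.cMax_nonneg)
  exact mul_le_mul_of_nonneg_left (pow_le_pow_left₀ h0.le h1 2) net.κ_pos.le

/-- A unit of traffic takes at least `pMin` energy and a task takes `κ * f i ^ 2`, so `cMax` is a
bound for the dropping cost saved per unit of energy. -/
theorem SlotFeasible.sum_unit_cost_le (hs : net.Admissible s) (hx : net.SlotFeasible s x) (i : BS) :
    ∑ u, (net.cTx u * x.α u i + net.cCom u * x.β u i) ≤ net.cMax * net.energy s x i := by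
  rw [energy, txEnergy, comEnergy, mul_add, Finset.sum_add_distrib, Finset.mul_sum,
    ← mul_assoc, Finset.mul_sum]
  refine add_le_add (Finset.sum_le_sum fun u _ => ?_) (Finset.sum_le_sum fun u _ => ?_)
  · rw [← mul_assoc]
    refine mul_le_mul_of_nonneg_right ((net.cTx_le u).trans ?_) (hx.α_nonneg u i)
    exact mul_le_mul_of_nonneg_left (hs.pMin_le i u) net.cMax_nonneg
  · exact mul_le_mul_of_nonneg_right (net.cCom_le u i) (hx.β_nonneg u i)

/-- Below the level `E^max`, GLOBE lets the base station idle. -/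
theorem SolvesP3.energy_eq_zero (hV : 0 < V) (hs : net.Admissible s) (hx : net.SolvesP3 V b s x)
    {i : BS} (hb : b i < net.EMax) : net.energy s x i = 0 := by
  let y : Decision BS U := (fun u j => if j = i then 0 else x.α u j,
    fun u j => if j = i then 0 else x.β u j, x.e, x.g)
  have hy : net.SlotFeasible s y := by
    refine hx.1.mono ?_ ?_ ?_ ?_ hx.1.e_nonneg (fun _ => le_rfl) hx.1.g_nonneg (fun _ => le_rfl)
    all_goals
      intro u j
      have := hx.1.α_nonneg u j
      have := hx.1.β_nonneg u j
      simp only [y, Decision.α, Decision.β] at *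
      split_ifs <;> first | exact le_rfl | assumption
  have h := hx.stationObjective_le hy i fun j hj => by
    simp [stationObjective, y, hj, energy, txEnergy, comEnergy, Decision.α, Decision.β,
      Decision.e, Decision.g]
  have hE : net.energy s y i = 0 := by
    simp [energy, txEnergy, comEnergy, y, Decision.α, Decision.β]
  have hα (u) : y.α u i = 0 := by simp [y, Decision.α]
  have hβ (u) : y.β u i = 0 := by simp [y, Decision.β]
  have he : y.e = x.e := rfl
  have hg : y.g = x.g := rfl
  simp only [stationObjective, hE, he, hg, hα, hβ, mul_zero, add_zero, Finset.sum_const_zero] at h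
  have h1 := mul_le_mul_of_nonneg_left (hx.1.sum_unit_cost_le hs i) hV.le
  -- Idling saves `(θ - b i)` per unit of energy and loses at most `V * cMax`; the difference of the
  -- two is `EMax - b i`.
  have h2 : (net.EMax - b i) * net.energy s x i ≤ 0 := by
    rw [θ] at h
    linarith
  exact le_antisymm (nonpos_of_mul_nonpos_right h2 (sub_pos.2 hb)) (hx.1.energy_nonneg hs i)

theorem SolvesP3.energy_le_level (hV : 0 < V) (hs : net.Admissible s) (hx : net.SolvesP3 V b s x)
    {i : BS} (hb : 0 ≤ b i) : net.energy s x i ≤ b i := by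
  rcases lt_or_ge (b i) net.EMax with h | h
  · exact (hx.energy_eq_zero hV hs h).trans_le hb
  · exact (hx.1.energy_le hs i).trans h

/-- Above `θ` the level cannot rise, and from `θ` or below one full charge still fits under `Bmax`.
-/
theorem SolvesP3.no_overflow {Bmax : ℝ} (hV : 0 < V) (hs : net.Admissible s)
    (hx : net.SolvesP3 V b s x)
    (hB : V * net.cMax + net.EMax + net.arrivalMax + net.gMax ≤ Bmax) {i : BS}
    (hb : b i ≤ Bmax) : b i - net.energy s x i + x.e i + x.g i ≤ Bmax := by
  have hE := hx.1.energy_nonneg hs i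
  rcases lt_or_ge (net.θ V) (b i) with h | h
  · have := hx.charge_eq_zero hV hs h
    linarith
  · have := hx.1.charge_le hs i
    rw [θ] at h
    linarith

end Slot

end Network

/-! ### Battery paths and Lyapunov drift. -/

namespace Network

variable {BS U : Type*} [Fintype BS] [Fintype U] [DecidableEq BS] {net : Network BS U}
  {V Bmax : ℝ} {b B₀ : BS → ℝ}

section Path

variable {s : ℕ → SlotState BS U} {x : ℕ → Decision BS U}

/-- Causality is only required at nonnegative levels, because this is all that P3 yields for GLOBE;
the induction supplies the nonnegativity. -/
theorem battery_mem (hx : ∀ t, net.SlotFeasible (s t) (x t))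
    (hB₀ : ∀ i, 0 ≤ B₀ i ∧ B₀ i ≤ Bmax)
    (hc : ∀ t i, 0 ≤ net.battery Bmax B₀ s x t i →
      net.energy (s t) (x t) i ≤ net.battery Bmax B₀ s x t i) (t : ℕ) (i : BS) :
    0 ≤ net.battery Bmax B₀ s x t i ∧ net.battery Bmax B₀ s x t i ≤ Bmax := by
  induction t with
  | zero => exact hB₀ i
  | succ t ih =>
    refine ⟨le_min ?_ ((hB₀ i).1.trans (hB₀ i).2), min_le_right _ _⟩
    have := hc t i ih.1
    have := (hx t).e_nonneg i
    have := (hx t).g_nonneg i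
    linarith

/-- A path along which every slot problem P3 is solved. -/
theorem battery_mem_of_solvesP3 (hV : 0 < V) (hs : ∀ t, net.Admissible (s t))
    (hB₀ : ∀ i, 0 ≤ B₀ i ∧ B₀ i ≤ Bmax)
    (hx : ∀ t, net.SolvesP3 V (net.battery Bmax B₀ s x t) (s t) (x t)) (t : ℕ) (i : BS) :
    0 ≤ net.battery Bmax B₀ s x t i ∧ net.battery Bmax B₀ s x t i ≤ Bmax :=
  battery_mem (fun t => (hx t).1) hB₀
    (fun t _ h => (hx t).energy_le_level hV (hs t) h) t i

theorem battery_succ_of_solvesP3 (hV : 0 < V) (hs : ∀ t, net.Admissible (s t))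
    (hB : V * net.cMax + net.EMax + net.arrivalMax + net.gMax ≤ Bmax)
    (hB₀ : ∀ i, 0 ≤ B₀ i ∧ B₀ i ≤ Bmax)
    (hx : ∀ t, net.SolvesP3 V (net.battery Bmax B₀ s x t) (s t) (x t)) (t : ℕ) (i : BS) :
    net.battery Bmax B₀ s x (t + 1) i = net.battery Bmax B₀ s x t i - net.energy (s t) (x t) i +
      (x t).e i + (x t).g i :=
  min_eq_left ((hx t).no_overflow hV (hs t) hB (battery_mem_of_solvesP3 hV hs hB₀ hx t i).2)

variable (net) in
theorem D_eq_sum : net.D = ∑ _i : BS, (net.EMax ^ 2 + (net.arrivalMax + net.gMax) ^ 2) / 2 := by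
  rw [Finset.sum_const, Finset.card_univ, nsmul_eq_mul, D]
  ring

/-- The one-step drift of the quadratic Lyapunov function. -/
theorem drift_le {s : SlotState BS U} {x : Decision BS U} (hs : net.Admissible s)
    (hx : net.SlotFeasible s x) {b' : BS → ℝ}
    (hb : ∀ i, b' i = b i - net.energy s x i + x.e i + x.g i) :
    V * ∑ i, net.cost s x i + ∑ i, (b' i - net.θ V) ^ 2 / 2 ≤
      net.objectiveP3 V b s x + net.D + ∑ i, (b i - net.θ V) ^ 2 / 2 := by
  rw [D_eq_sum, objectiveP3, Finset.mul_sum, ← Finset.sum_add_distrib, ← Finset.sum_add_distrib,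
    ← Finset.sum_add_distrib]
  refine Finset.sum_le_sum fun i _ => ?_
  have h1 := hx.energy_nonneg hs i
  have h2 := pow_le_pow_left₀ h1 (hx.energy_le hs i) 2
  have h3 := hx.charge_nonneg i
  have h4 := pow_le_pow_left₀ h3 (hx.charge_le hs i) 2
  -- Consumption and charge are both nonnegative, so the cross term in the square of their
  -- difference can be dropped. What remains is the summand of `D`.
  have h5 := mul_nonneg h1 h3
  rw [hb]
  linarith

/-- The drift bound accumulated along a path of solutions of P3. -/
theorem sum_cost_le_of_solvesP3 (hV : 0 < V) (hs : ∀ t, net.Admissible (s t))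
    (hB : V * net.cMax + net.EMax + net.arrivalMax + net.gMax ≤ Bmax)
    (hB₀ : ∀ i, 0 ≤ B₀ i ∧ B₀ i ≤ Bmax)
    (hx : ∀ t, net.SolvesP3 V (net.battery Bmax B₀ s x t) (s t) (x t)) (T : ℕ) :
    V * ∑ t ∈ Finset.range T, ∑ i, net.cost (s t) (x t) i ≤
      ∑ t ∈ Finset.range T, net.objectiveP3 V (net.battery Bmax B₀ s x t) (s t) (x t) +
        T * net.D + ∑ i, (B₀ i - net.θ V) ^ 2 / 2 := by
  suffices h : V * ∑ t ∈ Finset.range T, ∑ i, net.cost (s t) (x t) i +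
      ∑ i, (net.battery Bmax B₀ s x T i - net.θ V) ^ 2 / 2 ≤
      ∑ t ∈ Finset.range T, net.objectiveP3 V (net.battery Bmax B₀ s x t) (s t) (x t) +
        T * net.D + ∑ i, (B₀ i - net.θ V) ^ 2 / 2 from
    le_trans (le_add_of_nonneg_right (Finset.sum_nonneg fun i _ => by positivity)) h
  induction T with
  | zero => simp [battery]
  | succ T ih =>
    have := drift_le (V := V) (hs T) (hx T).1 (battery_succ_of_solvesP3 hV hs hB hB₀ hx T)
    rw [Finset.sum_range_succ, Finset.sum_range_succ]
    push_cast
    linarith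

end Path

/-! ### A shift that makes the objective of P3 nonnegative, for integration in `[0, ∞]`. -/

section Slack

variable (net) in
/-- A bound for the modulus of the battery term of the objective of P3 at battery levels in
`[0, Bmax]`. -/
def slack (V Bmax : ℝ) : ℝ :=
  ∑ _i : BS, (Bmax + |net.θ V|) * (net.EMax + (net.arrivalMax + net.gMax))

theorem abs_sub_θ_le {r : ℝ} (hr : 0 ≤ r ∧ r ≤ Bmax) : |r - net.θ V| ≤ Bmax + |net.θ V| :=
  (abs_sub _ _).trans (add_le_add_left ((abs_of_nonneg hr.1).trans_le hr.2) _)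

variable {s : SlotState BS U} {x : Decision BS U}

theorem SlotFeasible.EMax_nonneg (hs : net.Admissible s) (hx : net.SlotFeasible s x) (i : BS) :
    0 ≤ net.EMax :=
  (hx.energy_nonneg hs i).trans (hx.energy_le hs i)

theorem SlotFeasible.slack_nonneg (hs : net.Admissible s) (hx : net.SlotFeasible s x)
    (hb : ∀ i, 0 ≤ b i ∧ b i ≤ Bmax) : 0 ≤ net.slack V Bmax :=
  Finset.sum_nonneg fun i _ => mul_nonneg ((abs_nonneg _).trans (abs_sub_θ_le (hb i)))
    (add_nonneg (hx.EMax_nonneg hs i) ((hx.charge_nonneg i).trans (hx.charge_le hs i)))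

theorem SlotFeasible.objectiveP3_add_slack_nonneg (hV : 0 < V) (hs : net.Admissible s)
    (hx : net.SlotFeasible s x) (hb : ∀ i, 0 ≤ b i ∧ b i ≤ Bmax) :
    0 ≤ net.objectiveP3 V b s x + net.slack V Bmax := by
  rw [objectiveP3, slack, ← Finset.sum_add_distrib]
  refine Finset.sum_nonneg fun i _ => ?_
  have h1 := mul_nonneg hV.le (hx.cost_nonneg hs i)
  have h2 := hx.energy_nonneg hs i
  have h3 := hx.energy_le hs i
  have h4 := hx.charge_nonneg i
  have h5 := hx.charge_le hs i
  have h6 : |net.energy s x i - x.g i - x.e i| ≤ net.EMax + (net.arrivalMax + net.gMax) :=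
    abs_le.2 ⟨by linarith, by linarith⟩
  have h7 := mul_le_mul (abs_sub_θ_le (net := net) (V := V) (hb i)) h6 (abs_nonneg _)
    ((abs_nonneg _).trans (abs_sub_θ_le (net := net) (V := V) (hb i)))
  rw [← abs_mul] at h7
  have := le_abs_self ((b i - net.θ V) * (net.energy s x i - x.g i - x.e i))
  linarith

end Slack

/-! ### Lower bound along an arbitrary feasible path. -/

section NoOverflow

variable {s : ℕ → SlotState BS U} {x : ℕ → Decision BS U}

/-- Energy lost to overflow need not be drawn in the first place. -/
theorem SlotFeasible.exists_no_overflow {s : SlotState BS U} {x : Decision BS U}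
    (hs : net.Admissible s) (hx : net.SlotFeasible s x) (hb : ∀ i, b i ≤ Bmax) :
    ∃ y, net.SlotFeasible s y ∧ (∀ i, net.cost s y i ≤ net.cost s x i) ∧
      ∀ i, net.energy s y i - y.g i - y.e i =
        b i - min (b i - net.energy s x i + x.e i + x.g i) Bmax := by
  let o : BS → ℝ := fun i => max (b i - net.energy s x i + x.e i + x.g i - Bmax) 0
  have ho (i) : min (b i - net.energy s x i + x.e i + x.g i) Bmax =
      b i - net.energy s x i + x.e i + x.g i - o i := by
    simp only [o]
    rcases le_total (b i - net.energy s x i + x.e i + x.g i) Bmax with h | h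
    · rw [min_eq_left h, max_eq_right (by linarith)]; ring
    · rw [min_eq_right h, max_eq_left (by linarith)]; ring
  have ho0 (i) : 0 ≤ o i := le_max_right _ _
  have ho1 (i) : o i ≤ x.e i + x.g i := by
    have := hx.energy_nonneg hs i
    have := hb i
    exact max_le (by linarith) (hx.charge_nonneg i)
  -- The overflow `o` is taken out of `e` as far as possible and the rest out of `g`; `ho1` keeps
  -- the new `g` nonnegative.
  let y : Decision BS U := (x.α, x.β, fun i => x.e i - min (x.e i) (o i),
    fun i => x.g i - (o i - min (x.e i) (o i)))
  have hg (i) : y.g i ≤ x.g i := sub_le_self _ (sub_nonneg.2 (min_le_right _ _))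
  refine ⟨y, hx.mono hx.α_nonneg (fun _ _ => le_rfl) hx.β_nonneg (fun _ _ => le_rfl)
    (fun i => sub_nonneg.2 (min_le_left _ _))
    (fun i => sub_le_self _ (le_min (hx.e_nonneg i) (ho0 i))) (fun i => ?_) hg, fun i => ?_,
    fun i => ?_⟩
  · have := ho1 i
    have := hx.g_nonneg i
    change 0 ≤ x.g i - (o i - min (x.e i) (o i))
    rcases le_total (x.e i) (o i) with h | h
    · rw [min_eq_left h]; linarith
    · rw [min_eq_right h]; linarith
  · exact add_le_add_right (mul_le_mul_of_nonneg_left (hg i) hs.price_nonneg) _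
  · rw [ho]
    change net.energy s x i - (x.g i - (o i - min (x.e i) (o i))) - (x.e i - min (x.e i) (o i)) = _
    ring

/-- Any path that respects the constraints of P1 yields slot decisions whose objectives of P3, at
constant battery levels, are bounded on average by its costs. -/
theorem exists_sum_objectiveP3_le (hV : 0 < V) (hs : ∀ t, net.Admissible (s t))
    (hx : ∀ t, net.SlotFeasible (s t) (x t)) (hB₀ : ∀ i, 0 ≤ B₀ i ∧ B₀ i ≤ Bmax)
    (hc : ∀ t i, net.energy (s t) (x t) i ≤ net.battery Bmax B₀ s x t i) :
    ∃ y : ℕ → Decision BS U, (∀ t, net.SlotFeasible (s t) (y t)) ∧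
      ∀ b : BS → ℝ, (∀ i, 0 ≤ b i ∧ b i ≤ Bmax) → ∀ T,
        ∑ t ∈ Finset.range T, net.objectiveP3 V b (s t) (y t) ≤
          V * ∑ t ∈ Finset.range T, ∑ i, net.cost (s t) (x t) i +
            ∑ _i : BS, (Bmax + |net.θ V|) * Bmax := by
  have hmem := battery_mem hx hB₀ fun t i _ => hc t i
  choose y hy hcost hbat using fun t =>
    (hx t).exists_no_overflow (hs t) fun i => (hmem t i).2
  refine ⟨y, hy, fun b hb T => ?_⟩
  -- Since `b` is constant in time and the net consumption of `y` is the decrease of the battery of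
  -- `x`, the battery terms telescope. The remainder is bounded because both end levels lie in `[0,
  -- Bmax]`.
  have key : ∑ t ∈ Finset.range T, net.objectiveP3 V b (s t) (y t) ≤
      V * ∑ t ∈ Finset.range T, ∑ i, net.cost (s t) (x t) i -
        ∑ i, (b i - net.θ V) * (B₀ i - net.battery Bmax B₀ s x T i) := by
    induction T with
    | zero => simp [battery]
    | succ T ih =>
      have h : net.objectiveP3 V b (s T) (y T) ≤ V * ∑ i, net.cost (s T) (x T) i -
          ∑ i, (b i - net.θ V) *
            (net.battery Bmax B₀ s x T i - net.battery Bmax B₀ s x (T + 1) i) := by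
        rw [objectiveP3, Finset.mul_sum, ← Finset.sum_sub_distrib]
        refine Finset.sum_le_sum fun i _ => ?_
        rw [hbat T i]
        exact sub_le_sub_right (mul_le_mul_of_nonneg_left (hcost T i) hV.le) _
      have h2 : ∑ i, (b i - net.θ V) * (B₀ i - net.battery Bmax B₀ s x (T + 1) i) =
          ∑ i, (b i - net.θ V) * (B₀ i - net.battery Bmax B₀ s x T i) +
          ∑ i, (b i - net.θ V) *
            (net.battery Bmax B₀ s x T i - net.battery Bmax B₀ s x (T + 1) i) := by
        rw [← Finset.sum_add_distrib]
        exact Finset.sum_congr rfl fun i _ => by ring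
      rw [Finset.sum_range_succ, Finset.sum_range_succ]
      linarith
  refine key.trans ?_
  rw [sub_eq_add_neg, ← Finset.sum_neg_distrib]
  refine add_le_add_right (Finset.sum_le_sum fun i _ => (neg_le_abs _).trans ?_) _
  rw [abs_mul]
  have := hmem T i
  have := hB₀ i
  exact mul_le_mul (abs_sub_θ_le (hb i)) (abs_le.2 ⟨by linarith, by linarith⟩) (abs_nonneg _)
    ((abs_nonneg _).trans (abs_sub_θ_le (hb i)))

end NoOverflow

end Network

/-! ### A retraction onto the slot constraints. -/

/-- Scale `a` down where needed for its total not to exceed `c`. -/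
def capTotal {ι : Type*} (s : Finset ι) (c : ℝ) (a : ι → ℝ) (i : ι) : ℝ :=
  a i * (c / max c (∑ j ∈ s, a j))

section capTotal

variable {ι : Type*} {s : Finset ι} {c : ℝ} {a : ι → ℝ}

theorem capTotal_nonneg (hc : 0 ≤ c) (ha : ∀ i, 0 ≤ a i) (i : ι) : 0 ≤ capTotal s c a i :=
  mul_nonneg (ha i) (div_nonneg hc (hc.trans (le_max_left _ _)))

theorem capTotal_le (hc : 0 ≤ c) (ha : ∀ i, 0 ≤ a i) (i : ι) : capTotal s c a i ≤ a i :=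
  mul_le_of_le_one_right (ha i)
    (div_le_one_of_le₀ (le_max_left _ _) (hc.trans (le_max_left _ _)))

theorem sum_capTotal_le (hc : 0 ≤ c) : ∑ i ∈ s, capTotal s c a i ≤ c := by
  simp only [capTotal, ← Finset.sum_mul]
  rw [← mul_div_assoc, mul_comm, mul_div_assoc]
  exact mul_le_of_le_one_right hc (div_le_one_of_le₀ (le_max_right _ _) (hc.trans (le_max_left _ _)))

theorem capTotal_eq_self (ha : ∀ i, 0 ≤ a i) (h0 : ∀ i ∉ s, a i = 0) (h : ∑ j ∈ s, a j ≤ c)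
    (i : ι) : capTotal s c a i = a i := by
  rw [capTotal, max_eq_left h]
  -- For `c = 0` the scaling factor is `0 / 0 = 0`, but then all entries vanish anyway.
  rcases eq_or_ne c 0 with rfl | hc
  · have h1 : a i = 0 := by
      by_cases hi : i ∈ s
      · exact le_antisymm ((Finset.single_le_sum (fun j _ => ha j) hi).trans h) (ha i)
      · exact h0 i hi
    rw [h1, zero_mul]
  · rw [div_self hc, mul_one]

theorem continuous_capTotal (s : Finset ι) (hc : 0 ≤ c) (i : ι) :
    Continuous fun a : ι → ℝ => capTotal s c a i := by
  unfold capTotal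
  rcases hc.eq_or_lt with rfl | hc
  · simpa using continuous_const
  · exact (continuous_apply i).mul (continuous_const.div (by fun_prop)
      fun a => (hc.trans_le (le_max_left _ _)).ne')

theorem Measurable.capTotal {X : Type*} [MeasurableSpace X] (s : Finset ι) {c : X → ℝ}
    {a : X → ι → ℝ} (hc : Measurable c) (ha : ∀ i, Measurable fun x => a x i) (i : ι) :
    Measurable fun x => capTotal s (c x) (a x) i :=
  (ha i).mul (hc.div (hc.max (Finset.measurable_fun_sum s fun j _ => ha j)))

end capTotal

namespace Network

variable {BS U : Type*} [Fintype BS] [Fintype U] [DecidableEq BS] (net : Network BS U)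

/-- A retraction of all decisions to those that satisfy the slot constraints. -/
def retract (s : SlotState BS U) (q : Decision BS U) : Decision BS U :=
  (fun u => capTotal (net.reach u) (s.traffic u)
      fun j => if j ∈ net.reach u then max (q.α u j) 0 else 0,
    fun u i => capTotal Finset.univ (net.f i / net.ρ - 1 / net.dMax)
      (fun v => capTotal (net.reach v) (s.tasks v)
        (fun j => if j ∈ net.reach v then max (q.β v j) 0 else 0) i) u,
    fun i => min (max (q.e i) 0) (s.arrival i),
    fun i => min (max (q.g i) 0) net.gMax)

variable {net}

theorem slotFeasible_retract {s : SlotState BS U} (hs : net.Admissible s) (q : Decision BS U) :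
    net.SlotFeasible s (net.retract s q) := by
  have h0 (a : BS → ℝ) (u : U) (j : BS) : 0 ≤ if j ∈ net.reach u then max (a j) 0 else 0 := by
    split_ifs
    exacts [le_max_right _ _, le_rfl]
  have hα (u : U) := capTotal_nonneg (s := net.reach u) (hs.traffic_nonneg u) (h0 (q.α u) u)
  have hβ (u : U) := capTotal_nonneg (s := net.reach u) (hs.tasks_nonneg u) (h0 (q.β u) u)
  have hβ' (u : U) (i : BS) := capTotal_nonneg (s := Finset.univ) (net.capacity_nonneg i)
    (fun v => hβ v i) u
  -- The capacity cap is applied after the demand cap and only decreases entries, so the task demand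
  -- constraint survives it.
  have hle (u : U) (i : BS) := capTotal_le (s := Finset.univ) (net.capacity_nonneg i)
    (fun v => hβ v i) u
  exact
  { α_nonneg := hα
    β_nonneg := hβ'
    α_reach := fun u j hj => le_antisymm
      ((capTotal_le (hs.traffic_nonneg u) (h0 _ u) j).trans_eq (if_neg hj)) (hα u j)
    β_reach := fun u j hj => le_antisymm ((hle u j).trans
      ((capTotal_le (hs.tasks_nonneg u) (h0 _ u) j).trans_eq (if_neg hj))) (hβ' u j)
    traffic_demand := fun u => sum_capTotal_le (hs.traffic_nonneg u)
    tasks_demand := fun u => (Finset.sum_le_sum fun j _ => hle u j).trans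
      (sum_capTotal_le (hs.tasks_nonneg u))
    capacity := fun i => sum_capTotal_le (net.capacity_nonneg i)
    e_nonneg := fun i => le_min (le_max_right _ _) (hs.arrival_nonneg i)
    e_le := fun i => min_le_right _ _
    g_nonneg := fun i => le_min (le_max_right _ _) net.gMax_nonneg
    g_le := fun i => min_le_right _ _ }

/-- With this, a minimization over the feasible decisions, a set that varies with the state, becomes
one over all decisions. -/
theorem SlotFeasible.retract_eq {s : SlotState BS U} {x : Decision BS U}
    (hx : net.SlotFeasible s x) : net.retract s x = x := by
  have hα (u : U) (j : BS) : (if j ∈ net.reach u then max (x.α u j) 0 else 0) = x.α u j := by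
    split_ifs with h
    exacts [max_eq_left (hx.α_nonneg u j), (hx.α_reach u j h).symm]
  have hβ (u : U) (j : BS) : (if j ∈ net.reach u then max (x.β u j) 0 else 0) = x.β u j := by
    split_ifs with h
    exacts [max_eq_left (hx.β_nonneg u j), (hx.β_reach u j h).symm]
  have hβ' (u : U) (j : BS) : capTotal (net.reach u) (s.tasks u) (x.β u) j = x.β u j :=
    capTotal_eq_self (hx.β_nonneg u) (hx.β_reach u) (hx.tasks_demand u) j
  simp only [retract, hα, hβ, hβ']
  refine Prod.ext (funext₂ fun u j => ?_) (Prod.ext (funext₂ fun u i => ?_)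
    (Prod.ext (funext fun i => ?_) (funext fun i => ?_)))
  · exact capTotal_eq_self (hx.α_nonneg u) (hx.α_reach u) (hx.traffic_demand u) j
  · exact capTotal_eq_self (fun v => hx.β_nonneg v i) (fun v hv => absurd (Finset.mem_univ v) hv)
      (hx.capacity i) u
  · exact (congrArg (min · _) (max_eq_left (hx.e_nonneg i))).trans (min_eq_left (hx.e_le i))
  · exact (congrArg (min · _) (max_eq_left (hx.g_nonneg i))).trans (min_eq_left (hx.g_le i))

theorem continuous_retract {s : SlotState BS U} (hs : net.Admissible s) :
    Continuous (net.retract s) := by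
  have hα (u : U) (j : BS) : Continuous fun q : Decision BS U => q.α u j := by fun_prop
  have hβ (u : U) (j : BS) : Continuous fun q : Decision BS U => q.β u j := by fun_prop
  have hif {a : Decision BS U → ℝ} (ha : Continuous a) (u : U) (j : BS) :
      Continuous fun q => if j ∈ net.reach u then max (a q) 0 else 0 := by
    split_ifs
    exacts [ha.max continuous_const, continuous_const]
  have hβ' (v : U) (i : BS) := (continuous_capTotal (net.reach v) (hs.tasks_nonneg v) i).comp
    (continuous_pi fun j => hif (hβ v j) v j)
  refine .prodMk (continuous_pi fun u => continuous_pi fun j => ?_)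
    (.prodMk (continuous_pi fun u => continuous_pi fun i => ?_) (.prodMk ?_ ?_))
  · exact (continuous_capTotal (net.reach u) (hs.traffic_nonneg u) j).comp
      (continuous_pi fun j => hif (hα u j) u j)
  · exact (continuous_capTotal Finset.univ (net.capacity_nonneg i) u).comp
      (continuous_pi fun v => hβ' v i)
  · fun_prop
  · fun_prop

theorem measurable_retract (net : Network BS U) (q : Decision BS U) :
    Measurable fun s => net.retract s q := by
  have hα (u : U) : Measurable fun s : SlotState BS U => s.traffic u := by fun_prop
  have hβ (u : U) : Measurable fun s : SlotState BS U => s.tasks u := by fun_prop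
  have hβ' (v : U) (i : BS) := Measurable.capTotal (net.reach v) (hβ v)
    (a := fun _ j => if j ∈ net.reach v then max (q.β v j) 0 else 0)
    (fun _ => measurable_const) i
  refine .prodMk (measurable_pi_lambda _ fun u => measurable_pi_lambda _ fun j => ?_)
    (.prodMk (measurable_pi_lambda _ fun u => measurable_pi_lambda _ fun i => ?_) (.prodMk ?_ ?_))
  · exact Measurable.capTotal (net.reach u) (hα u)
      (a := fun _ j => if j ∈ net.reach u then max (q.α u j) 0 else 0)
      (fun _ => measurable_const) j
  · exact Measurable.capTotal Finset.univ (c := fun _ => net.f i / net.ρ - 1 / net.dMax)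
      measurable_const (fun v => hβ' v i) u
  · fun_prop
  · fun_prop

/-! ### Measurability of the optimal value of P3. -/

theorem measurable_cost (net : Network BS U) :
    Measurable fun z : SlotState BS U × Decision BS U => ∑ i, net.cost z.1 z.2 i := by
  unfold cost txCost comCost gridCost
  fun_prop

theorem measurable_energy (net : Network BS U) (i : BS) :
    Measurable fun z : SlotState BS U × Decision BS U => net.energy z.1 z.2 i := by
  unfold energy txEnergy comEnergy
  fun_prop

theorem measurable_objectiveP3 (net : Network BS U) (V : ℝ) :
    Measurable fun z : (BS → ℝ) × SlotState BS U × Decision BS U =>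
      net.objectiveP3 V z.1 z.2.1 z.2.2 := by
  unfold objectiveP3 energy txEnergy comEnergy cost txCost comCost gridCost
  fun_prop

theorem continuous_objectiveP3 (net : Network BS U) (V : ℝ) (b : BS → ℝ) (s : SlotState BS U) :
    Continuous (net.objectiveP3 V b s) := by
  unfold objectiveP3 energy txEnergy comEnergy cost txCost comCost gridCost
  fun_prop

/-- The optimal value of P3, shifted by `slack`, as a measurable function of the battery levels and
the state: the infimum is taken over a countable dense set of decisions. -/
def valueP3 (net : Network BS U) (V Bmax : ℝ) (b : BS → ℝ) (s : SlotState BS U) : ℝ≥0∞ :=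
  ⨅ n, ENNReal.ofReal (net.objectiveP3 V b s
    (net.retract s (TopologicalSpace.denseSeq (Decision BS U) n)) + net.slack V Bmax)

theorem measurable_objectiveP3_retract (net : Network BS U) (V : ℝ) (q : Decision BS U) :
    Measurable fun z : (BS → ℝ) × SlotState BS U =>
      net.objectiveP3 V z.1 z.2 (net.retract z.2 q) :=
  (net.measurable_objectiveP3 V).comp (f := fun z : (BS → ℝ) × SlotState BS U =>
      (z.1, z.2, net.retract z.2 q))
    (measurable_fst.prodMk (measurable_snd.prodMk ((net.measurable_retract q).comp measurable_snd)))

theorem measurable_valueP3 (net : Network BS U) (V Bmax : ℝ) :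
    Measurable fun z : (BS → ℝ) × SlotState BS U => net.valueP3 V Bmax z.1 z.2 :=
  Measurable.iInf fun n => ((net.measurable_objectiveP3_retract V
    (TopologicalSpace.denseSeq (Decision BS U) n)).add_const _).ennreal_ofReal

variable {V Bmax : ℝ} {b : BS → ℝ} {s : SlotState BS U} {x : Decision BS U}

theorem SolvesP3.le_valueP3 (hs : net.Admissible s) (hx : net.SolvesP3 V b s x) :
    ENNReal.ofReal (net.objectiveP3 V b s x + net.slack V Bmax) ≤ net.valueP3 V Bmax b s :=
  le_iInf fun _ => ENNReal.ofReal_le_ofReal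
    (add_le_add_left (hx.2 (slotFeasible_retract hs _)) _)

/-- The decisions `q` for which the bound holds at `retract s q` form a closed set that contains a
dense sequence, hence every decision; `x` is its own retraction. -/
theorem SlotFeasible.valueP3_le (hs : net.Admissible s) (hx : net.SlotFeasible s x) :
    net.valueP3 V Bmax b s ≤ ENNReal.ofReal (net.objectiveP3 V b s x + net.slack V Bmax) := by
  have hcont : Continuous fun q => ENNReal.ofReal
      (net.objectiveP3 V b s (net.retract s q) + net.slack V Bmax) :=
    ENNReal.continuous_ofReal.comp
      (((net.continuous_objectiveP3 V b s).comp (continuous_retract hs)).add_const _)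
  have hclosed := isClosed_le (continuous_const (y := net.valueP3 V Bmax b s)) hcont
  have hle (n : ℕ) : net.valueP3 V Bmax b s ≤ ENNReal.ofReal (net.objectiveP3 V b s
      (net.retract s (TopologicalSpace.denseSeq (Decision BS U) n)) + net.slack V Bmax) :=
    iInf_le _ n
  have huniv := closure_minimal (s := Set.range (TopologicalSpace.denseSeq (Decision BS U)))
    (by rintro _ ⟨n, rfl⟩; exact hle n) hclosed
  have h : x ∈ closure (Set.range (TopologicalSpace.denseSeq (Decision BS U))) :=
    TopologicalSpace.denseRange_denseSeq _ x
  simpa only [hx.retract_eq, Set.mem_ofPred_eq] using huniv h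

end Network

/-! ### The pathwise bounds in `[0, ∞]`. -/

namespace Network

variable {BS U : Type*} [Fintype BS] [Fintype U] [DecidableEq BS] {net : Network BS U}
  {V Bmax : ℝ} {b B₀ : BS → ℝ}

section Path

variable {s : ℕ → SlotState BS U} {x : ℕ → Decision BS U}

theorem ofReal_mul_sum_cost (hV : 0 < V) (hs : ∀ t, net.Admissible (s t))
    (hx : ∀ t, net.SlotFeasible (s t) (x t)) (T : ℕ) :
    ENNReal.ofReal (V * ∑ t ∈ Finset.range T, ∑ i, net.cost (s t) (x t) i) =
      ENNReal.ofReal V * ∑ t ∈ Finset.range T, ENNReal.ofReal (∑ i, net.cost (s t) (x t) i) := by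
  rw [ENNReal.ofReal_mul hV.le, ENNReal.ofReal_sum_of_nonneg fun t _ =>
    Finset.sum_nonneg fun i _ => (hx t).cost_nonneg (hs t) i]

theorem sum_valueP3_le (hV : 0 < V) (hs : ∀ t, net.Admissible (s t))
    (hx : ∀ t, net.SlotFeasible (s t) (x t)) (hB₀ : ∀ i, 0 ≤ B₀ i ∧ B₀ i ≤ Bmax)
    (hc : ∀ t i, net.energy (s t) (x t) i ≤ net.battery Bmax B₀ s x t i)
    (hb : ∀ i, 0 ≤ b i ∧ b i ≤ Bmax) (T : ℕ) :
    ∑ t ∈ Finset.range T, net.valueP3 V Bmax b (s t) ≤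
      ENNReal.ofReal V * ∑ t ∈ Finset.range T, ENNReal.ofReal (∑ i, net.cost (s t) (x t) i) +
        (T * ENNReal.ofReal (net.slack V Bmax) +
          ENNReal.ofReal (∑ _i : BS, (Bmax + |net.θ V|) * Bmax)) := by
  obtain ⟨y, hy, hle⟩ := exists_sum_objectiveP3_le hV hs hx hB₀ hc
  calc ∑ t ∈ Finset.range T, net.valueP3 V Bmax b (s t)
    _ ≤ ∑ t ∈ Finset.range T, ENNReal.ofReal (net.objectiveP3 V b (s t) (y t) +
          net.slack V Bmax) := Finset.sum_le_sum fun t _ => (hy t).valueP3_le (hs t)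
    _ = ENNReal.ofReal (∑ t ∈ Finset.range T, net.objectiveP3 V b (s t) (y t) +
          T * net.slack V Bmax) := by
      rw [← ENNReal.ofReal_sum_of_nonneg fun t _ =>
        (hy t).objectiveP3_add_slack_nonneg hV (hs t) hb, Finset.sum_add_distrib]
      simp
    _ ≤ ENNReal.ofReal (V * ∑ t ∈ Finset.range T, ∑ i, net.cost (s t) (x t) i +
          (T * net.slack V Bmax + ∑ _i : BS, (Bmax + |net.θ V|) * Bmax)) :=
      ENNReal.ofReal_le_ofReal (by linarith [hle b hb T])
    _ ≤ _ := by
      refine ENNReal.ofReal_add_le.trans (add_le_add (ofReal_mul_sum_cost hV hs hx T).le ?_)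
      refine ENNReal.ofReal_add_le.trans (add_le_add_left ?_ _)
      rw [ENNReal.ofReal_mul (Nat.cast_nonneg T), ENNReal.ofReal_natCast]

theorem mul_sum_cost_add_le_of_solvesP3 (hV : 0 < V) (hs : ∀ t, net.Admissible (s t))
    (hB : V * net.cMax + net.EMax + net.arrivalMax + net.gMax ≤ Bmax)
    (hB₀ : ∀ i, 0 ≤ B₀ i ∧ B₀ i ≤ Bmax)
    (hx : ∀ t, net.SolvesP3 V (net.battery Bmax B₀ s x t) (s t) (x t)) (T : ℕ) :
    ENNReal.ofReal V * ∑ t ∈ Finset.range T, ENNReal.ofReal (∑ i, net.cost (s t) (x t) i) +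
        T * ENNReal.ofReal (net.slack V Bmax) ≤
      ∑ t ∈ Finset.range T, net.valueP3 V Bmax (net.battery Bmax B₀ s x t) (s t) +
        (T * ENNReal.ofReal net.D + ENNReal.ofReal (∑ i, (B₀ i - net.θ V) ^ 2 / 2)) := by
  have hb := battery_mem_of_solvesP3 hV hs hB₀ hx
  -- The bounds inside `slack` are known to be nonnegative only through a feasible decision; the one
  -- of slot `0` serves.
  have hslack : 0 ≤ net.slack V Bmax := (hx 0).1.slack_nonneg (hs 0) hB₀
  have hcost : 0 ≤ V * ∑ t ∈ Finset.range T, ∑ i, net.cost (s t) (x t) i :=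
    mul_nonneg hV.le (Finset.sum_nonneg fun t _ => Finset.sum_nonneg fun i _ =>
      (hx t).1.cost_nonneg (hs t) i)
  calc _ = ENNReal.ofReal (V * ∑ t ∈ Finset.range T, ∑ i, net.cost (s t) (x t) i +
          T * net.slack V Bmax) := by
        rw [ENNReal.ofReal_add hcost (by positivity), ENNReal.ofReal_mul (Nat.cast_nonneg T),
          ENNReal.ofReal_natCast, ofReal_mul_sum_cost hV hs fun t => (hx t).1]
    _ ≤ ENNReal.ofReal (∑ t ∈ Finset.range T,
          (net.objectiveP3 V (net.battery Bmax B₀ s x t) (s t) (x t) + net.slack V Bmax) +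
          (T * net.D + ∑ i, (B₀ i - net.θ V) ^ 2 / 2)) := by
        refine ENNReal.ofReal_le_ofReal ?_
        have := sum_cost_le_of_solvesP3 hV hs hB hB₀ hx T
        rw [Finset.sum_add_distrib]
        simp only [Finset.sum_const, Finset.card_range, nsmul_eq_mul]
        linarith
    _ ≤ _ := by
        refine ENNReal.ofReal_add_le.trans (add_le_add ?_ ?_)
        · rw [ENNReal.ofReal_sum_of_nonneg fun t _ =>
            (hx t).1.objectiveP3_add_slack_nonneg hV (hs t) (hb t)]
          exact Finset.sum_le_sum fun t _ => (hx t).le_valueP3 (hs t)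
        · refine ENNReal.ofReal_add_le.trans (add_le_add_left ?_ _)
          rw [ENNReal.ofReal_mul (Nat.cast_nonneg T), ENNReal.ofReal_natCast]

end Path

/-- Only slots before `t` are assumed measurable, so that the lemma also applies to the σ-algebra of
the preceding slot. -/
theorem measurable_battery {Ω : Type*} [MeasurableSpace Ω] {S : ℕ → Ω → SlotState BS U}
    {x : ℕ → Ω → Decision BS U} {t : ℕ} (hS : ∀ r < t, Measurable (S r))
    (hx : ∀ r < t, Measurable (x r)) :
    Measurable fun ω => net.battery Bmax B₀ (fun r => S r ω) (fun r => x r ω) t := by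
  induction t with
  | zero => exact measurable_const
  | succ t ih =>
    have hb := ih (fun r hr => hS r (hr.trans t.lt_succ_self))
      (fun r hr => hx r (hr.trans t.lt_succ_self))
    have hxt := hx t t.lt_succ_self
    have hE (i : BS) : Measurable fun ω => net.energy (S t ω) (x t ω) i :=
      (net.measurable_energy i).comp ((hS t t.lt_succ_self).prodMk hxt)
    refine measurable_pi_lambda _ fun i => ?_
    exact ((((measurable_pi_apply i).comp hb).sub (hE i)).add (by fun_prop) |>.add
      (by fun_prop)).min measurable_const

theorem measurable_valueP3_battery {Ω : Type*} [MeasurableSpace Ω] {S : ℕ → Ω → SlotState BS U}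
    {x : ℕ → Ω → Decision BS U} (hS : ∀ t, Measurable (S t)) (hx : ∀ t, Measurable (x t)) (t : ℕ) :
    Measurable fun ω => net.valueP3 V Bmax
      (net.battery Bmax B₀ (fun r => S r ω) (fun r => x r ω) t) (S t ω) :=
  (net.measurable_valueP3 V Bmax).comp (f := fun ω =>
      (net.battery Bmax B₀ (fun r => S r ω) (fun r => x r ω) t, S t ω))
    ((measurable_battery (fun r _ => hS r) fun r _ => hx r).prodMk (hS t))

/-! ### Expectations: weak duality, independence and the cost bound. -/

section Policy

variable {Ω : Type*} [MeasurableSpace Ω] {P : Measure Ω} {ℱ : Filtration ℕ ‹MeasurableSpace Ω›}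
  {S : ℕ → Ω → SlotState BS U} {x : ℕ → Ω → Decision BS U}

theorem IsGLOBE.feasibleP1 (hV : 0 < V) (hadm : ∀ᵐ ω ∂P, ∀ t, net.Admissible (S t ω))
    (hB₀ : ∀ i, 0 ≤ B₀ i ∧ B₀ i ≤ Bmax) (hx : net.IsGLOBE P ℱ V Bmax B₀ S x) :
    net.FeasibleP1 P Bmax B₀ S x where
  measurable t := (hx.adapted t).mono (ℱ.le t) le_rfl
  slotFeasible := hx.solves.mono fun _ h t => (h t).1
  causality := by
    filter_upwards [hadm, hx.solves] with ω hs h t i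
    exact (h t).energy_le_level hV (hs t) (battery_mem_of_solvesP3 hV hs hB₀ h t i).1

theorem _root_.IIDStates.measurable (hS : IIDStates P ℱ S) (t : ℕ) : Measurable (S t) :=
  (hS.adapted t).mono (ℱ.le t) le_rfl

theorem measurable_valueP3_right (net : Network BS U) (V Bmax : ℝ) (b : BS → ℝ) :
    Measurable fun s => net.valueP3 V Bmax b s :=
  (net.measurable_valueP3 V Bmax).comp (f := fun s : SlotState BS U => (b, s))
    (measurable_const.prodMk measurable_id)

theorem lintegral_sum_cost {x : ℕ → Ω → Decision BS U} (hS : ∀ t, Measurable (S t))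
    (hx : ∀ t, Measurable (x t)) (T : ℕ) :
    ∫⁻ ω, ENNReal.ofReal V * ∑ t ∈ Finset.range T,
        ENNReal.ofReal (∑ i, net.cost (S t ω) (x t ω) i) ∂P =
      ENNReal.ofReal V * ∑ t ∈ Finset.range T,
        ∫⁻ ω, ENNReal.ofReal (∑ i, net.cost (S t ω) (x t ω) i) ∂P := by
  have h (t : ℕ) : Measurable fun ω => ENNReal.ofReal (∑ i, net.cost (S t ω) (x t ω) i) :=
    (net.measurable_cost.comp ((hS t).prodMk (hx t))).ennreal_ofReal
  rw [lintegral_const_mul _ (Finset.measurable_fun_sum _ fun t _ => h t),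
    lintegral_finsetSum _ fun t _ => h t]

variable [IsProbabilityMeasure P]

/-- Weak duality: at constant battery levels, the expected optimal value of P3 bounds the average
costs of all feasible policies from below. -/
theorem FeasibleP1.lintegral_valueP3_le (hV : 0 < V) (hS : IIDStates P ℱ S)
    (hadm : ∀ᵐ ω ∂P, ∀ t, net.Admissible (S t ω)) (hB₀ : ∀ i, 0 ≤ B₀ i ∧ B₀ i ≤ Bmax)
    (hx : net.FeasibleP1 P Bmax B₀ S x) (hb : ∀ i, 0 ≤ b i ∧ b i ≤ Bmax) (T : ℕ) :
    T * ∫⁻ ω, net.valueP3 V Bmax b (S 0 ω) ∂P ≤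
      ENNReal.ofReal V * ∑ t ∈ Finset.range T,
        ∫⁻ ω, ENNReal.ofReal (∑ i, net.cost (S t ω) (x t ω) i) ∂P +
        (T * ENNReal.ofReal (net.slack V Bmax) +
          ENNReal.ofReal (∑ _i : BS, (Bmax + |net.θ V|) * Bmax)) := by
  have hm := net.measurable_valueP3_right V Bmax b
  -- Only the equality of the laws of the states enters here, not independence; so the decisions may
  -- depend on the future.
  have heq (t : ℕ) : ∫⁻ ω, net.valueP3 V Bmax b (S t ω) ∂P =
      ∫⁻ ω, net.valueP3 V Bmax b (S 0 ω) ∂P :=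
    ((hS.identDistrib t).comp hm).lintegral_eq
  calc _ = ∫⁻ ω, ∑ t ∈ Finset.range T, net.valueP3 V Bmax b (S t ω) ∂P := by
        have hv (t : ℕ) : Measurable fun ω => net.valueP3 V Bmax b (S t ω) :=
          hm.comp (hS.measurable t)
        rw [lintegral_finsetSum _ fun t _ => hv t]
        simp [heq]
    _ ≤ ∫⁻ ω, (ENNReal.ofReal V * ∑ t ∈ Finset.range T,
          ENNReal.ofReal (∑ i, net.cost (S t ω) (x t ω) i) +
        (T * ENNReal.ofReal (net.slack V Bmax) +
          ENNReal.ofReal (∑ _i : BS, (Bmax + |net.θ V|) * Bmax))) ∂P := by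
        refine lintegral_mono_ae ?_
        filter_upwards [hadm, hx.slotFeasible, hx.causality] with ω hs hf hc
        exact sum_valueP3_le hV hs hf hB₀ hc hb T
    _ = _ := by
        rw [lintegral_add_right _ measurable_const, lintegral_const, measure_univ, mul_one,
          lintegral_sum_cost hS.measurable hx.measurable]

theorem lintegral_valueP3_le_optP1 (hV : 0 < V) (hS : IIDStates P ℱ S)
    (hadm : ∀ᵐ ω ∂P, ∀ t, net.Admissible (S t ω)) (hB₀ : ∀ i, 0 ≤ B₀ i ∧ B₀ i ≤ Bmax)
    (hb : ∀ i, 0 ≤ b i ∧ b i ≤ Bmax) :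
    ∫⁻ ω, net.valueP3 V Bmax b (S 0 ω) ∂P ≤
      net.optP1 P Bmax B₀ S * ENNReal.ofReal V + ENNReal.ofReal (net.slack V Bmax) := by
  have hV0 : ENNReal.ofReal V ≠ 0 := by simpa using hV
  -- Isolating `optP1` reduces the claim to one feasible policy at a time; the telescoping
  -- remainder, divided by `T`, vanishes in the limit.
  rw [← tsub_le_iff_right, ← ENNReal.div_le_iff hV0 ENNReal.ofReal_ne_top]
  refine le_iInf₂ fun y hy => ?_
  set C := ENNReal.ofReal (∑ _i : BS, (Bmax + |net.θ V|) * Bmax) / ENNReal.ofReal V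
  have hCV : C * ENNReal.ofReal V = ENNReal.ofReal (∑ _i : BS, (Bmax + |net.θ V|) * Bmax) :=
    ENNReal.div_mul_cancel hV0 ENNReal.ofReal_ne_top
  have hC_top : C ≠ ∞ := ENNReal.div_ne_top ENNReal.ofReal_ne_top hV0
  have hlim : Tendsto (fun T : ℕ => C / T) atTop (nhds 0) :=
    ENNReal.Tendsto.const_div ENNReal.tendsto_nat_nhds_top (Or.inr hC_top) |>.trans (by simp)
  rw [← ENNReal.liminf_add_of_right_tendsto_zero hlim]
  refine le_liminf_of_le (by isBoundedDefault) ?_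
  filter_upwards [eventually_ge_atTop 1] with T hT
  have hT0 : (T : ℝ≥0∞) ≠ 0 := by simpa using (Nat.one_le_iff_ne_zero.1 hT)
  have hTt : (T : ℝ≥0∞) ≠ ∞ := ENNReal.natCast_ne_top T
  rw [ENNReal.div_le_iff hV0 ENNReal.ofReal_ne_top, tsub_le_iff_right, Pi.add_apply, avgCost,
    ← ENNReal.mul_le_mul_iff_right hT0 hTt]
  refine (hy.lintegral_valueP3_le hV hS hadm hB₀ hb T).trans_eq ?_
  rw [← ENNReal.add_div, mul_add, ← mul_assoc, ENNReal.mul_div_cancel hT0 hTt, add_mul _ C,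
    hCV]
  ring

/-- The level of slot `t + 1` is `ℱ t`-measurable, and the state of that slot is independent of `ℱ
t`; the initial level is constant. -/
theorem indepFun_battery (hS : IIDStates P ℱ S) (hx : net.IsGLOBE P ℱ V Bmax B₀ S x) (t : ℕ) :
    IndepFun (fun ω => net.battery Bmax B₀ (fun r => S r ω) (fun r => x r ω) t) (S t) P := by
  cases t with
  | zero => exact indepFun_const_left B₀ (S 0)
  | succ t =>
    have hm : Measurable[ℱ t]
        (fun ω => net.battery Bmax B₀ (fun r => S r ω) (fun r => x r ω) (t + 1)) :=
      @measurable_battery _ _ _ _ _ _ _ _ _ (ℱ t) _ _ _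
        (fun r hr => (hS.adapted r).mono (ℱ.mono (Nat.lt_succ_iff.1 hr)) le_rfl)
        (fun r hr => (hx.adapted r).mono (ℱ.mono (Nat.lt_succ_iff.1 hr)) le_rfl)
    rw [IndepFun_iff_Indep]
    exact (indep_of_indep_of_le_right (hS.indep t) hm.comap_le).symm

/-- By independence the joint law is a product, so the state can be integrated out with the level
held fixed, where weak duality applies. -/
theorem IsGLOBE.lintegral_valueP3_le (hV : 0 < V) (hS : IIDStates P ℱ S)
    (hadm : ∀ᵐ ω ∂P, ∀ t, net.Admissible (S t ω)) (hB₀ : ∀ i, 0 ≤ B₀ i ∧ B₀ i ≤ Bmax)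
    (hx : net.IsGLOBE P ℱ V Bmax B₀ S x) (t : ℕ) :
    ∫⁻ ω, net.valueP3 V Bmax (net.battery Bmax B₀ (fun r => S r ω) (fun r => x r ω) t) (S t ω) ∂P ≤
      net.optP1 P Bmax B₀ S * ENNReal.ofReal V + ENNReal.ofReal (net.slack V Bmax) := by
  set B := fun ω => net.battery Bmax B₀ (fun r => S r ω) (fun r => x r ω) t
  have hBm : Measurable B := measurable_battery (fun r _ => hS.measurable r)
    fun r _ => (hx.adapted r).mono (ℱ.le r) le_rfl
  have hSm := hS.measurable t
  have hm := net.measurable_valueP3 V Bmax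
  have hlaw := (indepFun_iff_map_prod_eq_prod_map_map hBm.aemeasurable hSm.aemeasurable).1
    (indepFun_battery hS hx t)
  have : IsProbabilityMeasure (P.map (S t)) := Measure.isProbabilityMeasure_map hSm.aemeasurable
  calc _ = ∫⁻ z, net.valueP3 V Bmax z.1 z.2 ∂(P.map fun ω => (B ω, S t ω)) :=
        (lintegral_map hm (hBm.prodMk hSm)).symm
    _ = ∫⁻ ω, ∫⁻ s, net.valueP3 V Bmax (B ω) s ∂(P.map (S t)) ∂P := by
        rw [hlaw, lintegral_prod _ hm.aemeasurable, lintegral_map hm.lintegral_prod_right' hBm]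
    _ ≤ ∫⁻ _, (net.optP1 P Bmax B₀ S * ENNReal.ofReal V +
          ENNReal.ofReal (net.slack V Bmax)) ∂P := by
        refine lintegral_mono_ae ?_
        filter_upwards [hadm, hx.solves] with ω hs h
        rw [(hS.identDistrib t).map_eq,
          lintegral_map (net.measurable_valueP3_right V Bmax _) (hS.measurable 0)]
        exact lintegral_valueP3_le_optP1 hV hS hadm hB₀
          (battery_mem_of_solvesP3 hV hs hB₀ h t)
    _ = _ := by simp

theorem IsGLOBE.limsup_avgCost_le (hV : 0 < V) (hS : IIDStates P ℱ S)
    (hadm : ∀ᵐ ω ∂P, ∀ t, net.Admissible (S t ω))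
    (hB : V * net.cMax + net.EMax + net.arrivalMax + net.gMax ≤ Bmax)
    (hB₀ : ∀ i, 0 ≤ B₀ i ∧ B₀ i ≤ Bmax) (hx : net.IsGLOBE P ℱ V Bmax B₀ S x) :
    limsup (net.avgCost P S x) atTop ≤
      net.optP1 P Bmax B₀ S + ENNReal.ofReal (net.D / V) := by
  have hV0 : ENNReal.ofReal V ≠ 0 := by simpa using hV
  have hxm := (hx.feasibleP1 hV hadm hB₀).measurable
  set C := ENNReal.ofReal (∑ i, (B₀ i - net.θ V) ^ 2 / 2) / ENNReal.ofReal V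
  have hC_top : C ≠ ∞ := ENNReal.div_ne_top ENNReal.ofReal_ne_top hV0
  have hlim : Tendsto (fun T : ℕ => C / T) atTop (nhds 0) :=
    ENNReal.Tendsto.const_div ENNReal.tendsto_nat_nhds_top (Or.inr hC_top) |>.trans (by simp)
  have hbound (T : ℕ) (hT : 1 ≤ T) : net.avgCost P S x T ≤
      net.optP1 P Bmax B₀ S + ENNReal.ofReal (net.D / V) + C / T := by
    have hT0 : (T : ℝ≥0∞) ≠ 0 := by simpa using (Nat.one_le_iff_ne_zero.1 hT)
    have hTt : (T : ℝ≥0∞) ≠ ∞ := ENNReal.natCast_ne_top T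
    have hslack : (T : ℝ≥0∞) * ENNReal.ofReal (net.slack V Bmax) ≠ ∞ :=
      ENNReal.mul_ne_top hTt ENNReal.ofReal_ne_top
    have hv (t : ℕ) : Measurable fun ω => net.valueP3 V Bmax
        (net.battery Bmax B₀ (fun r => S r ω) (fun r => x r ω) t) (S t ω) :=
      measurable_valueP3_battery hS.measurable hxm t
    -- The factors `T`, `V` and the summand `T * slack` are finite, so clearing denominators and
    -- adding the shift on both sides are equivalences in `[0, ∞]`.
    rw [avgCost, ENNReal.div_le_iff hT0 hTt, ← ENNReal.mul_le_mul_iff_right hV0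
      ENNReal.ofReal_ne_top, ← ENNReal.add_le_add_iff_right hslack, add_mul _ (C / T),
      ENNReal.div_mul_cancel hT0 hTt, ENNReal.ofReal_div_of_pos hV]
    calc _ = ∫⁻ ω, (ENNReal.ofReal V * ∑ t ∈ Finset.range T,
            ENNReal.ofReal (∑ i, net.cost (S t ω) (x t ω) i) +
            T * ENNReal.ofReal (net.slack V Bmax)) ∂P := by
          rw [lintegral_add_right _ measurable_const, lintegral_const, measure_univ, mul_one,
            lintegral_sum_cost hS.measurable hxm]
      _ ≤ ∫⁻ ω, (∑ t ∈ Finset.range T, net.valueP3 V Bmax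
            (net.battery Bmax B₀ (fun r => S r ω) (fun r => x r ω) t) (S t ω) +
            (T * ENNReal.ofReal net.D +
              ENNReal.ofReal (∑ i, (B₀ i - net.θ V) ^ 2 / 2))) ∂P := by
          refine lintegral_mono_ae ?_
          filter_upwards [hadm, hx.solves] with ω hs h
          exact mul_sum_cost_add_le_of_solvesP3 hV hs hB hB₀ h T
      _ = ∑ t ∈ Finset.range T, ∫⁻ ω, net.valueP3 V Bmax
            (net.battery Bmax B₀ (fun r => S r ω) (fun r => x r ω) t) (S t ω) ∂P +
            (T * ENNReal.ofReal net.D + ENNReal.ofReal (∑ i, (B₀ i - net.θ V) ^ 2 / 2)) := by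
          rw [lintegral_add_right _ measurable_const, lintegral_const, measure_univ, mul_one,
            lintegral_finsetSum _ fun t _ => hv t]
      _ ≤ T * (net.optP1 P Bmax B₀ S * ENNReal.ofReal V + ENNReal.ofReal (net.slack V Bmax)) +
            (T * ENNReal.ofReal net.D + ENNReal.ofReal (∑ i, (B₀ i - net.θ V) ^ 2 / 2)) := by
          refine add_le_add_left ((Finset.sum_le_sum fun t _ =>
            hx.lintegral_valueP3_le hV hS hadm hB₀ t).trans_eq ?_) _
          rw [Finset.sum_const, Finset.card_range, nsmul_eq_mul]
      _ = _ := by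
          have hD : ENNReal.ofReal V * (ENNReal.ofReal net.D / ENNReal.ofReal V) =
            ENNReal.ofReal net.D := ENNReal.mul_div_cancel hV0 ENNReal.ofReal_ne_top
          have hC' : ENNReal.ofReal V * C = ENNReal.ofReal (∑ i, (B₀ i - net.θ V) ^ 2 / 2) :=
            ENNReal.mul_div_cancel hV0 ENNReal.ofReal_ne_top
          generalize ENNReal.ofReal net.D / ENNReal.ofReal V = d at hD ⊢
          rw [← hC', ← hD]
          ring
  calc limsup (net.avgCost P S x) atTop
    _ ≤ limsup ((fun _ : ℕ => net.optP1 P Bmax B₀ S + ENNReal.ofReal (net.D / V)) +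
          fun T : ℕ => C / T) atTop :=
        limsup_le_limsup ((eventually_ge_atTop 1).mono hbound)
    _ = _ := by rw [ENNReal.limsup_add_of_right_tendsto_zero hlim, limsup_const]

end Policy

end Network

end

theorem theorem1 {BS U Ω : Type*} [Fintype BS] [DecidableEq BS] [Fintype U]
    [MeasurableSpace Ω] (P : Measure Ω) [IsProbabilityMeasure P]
    (net : Network BS U)
    (ℱ : Filtration ℕ ‹MeasurableSpace Ω›) (S : ℕ → Ω → SlotState BS U)
    (hS : IIDStates P ℱ S) (hadm : ∀ᵐ ω ∂P, ∀ t, net.Admissible (S t ω))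
    (V Bmax : ℝ) (hV : 0 < V)
    (hB : V * net.cMax + net.EMax + net.arrivalMax + net.gMax ≤ Bmax)
    (B₀ : BS → ℝ) (hB₀ : ∀ i, 0 ≤ B₀ i ∧ B₀ i ≤ Bmax)
    (x : ℕ → Ω → Decision BS U) (hx : net.IsGLOBE P ℱ V Bmax B₀ S x) :
    net.FeasibleP1 P Bmax B₀ S x ∧
      limsup (net.avgCost P S x) atTop ≤
        net.optP1 P Bmax B₀ S + ENNReal.ofReal (net.D / V) :=
  ⟨hx.feasibleP1 hV hadm hB₀, hx.limsup_avgCost_le hV hS hadm hB hB₀⟩
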